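/- For each $i\in\mathbb N=\{1,2,\dots\}$ let $f_i:\mathbb R^d\to\mathbb R^d$ be a similarity with ratio $\sigma_i\in(0,1)$, i.e. $|f_i(x)-f_i(y)|=\sigma_i|x-y|$ for all $x,y\in\mathbb R^d$, and for each $k\in\mathbb N$ let $\mathcal I_k\subset\mathbb N$ be a finite index set (a non-autonomous iterated function system of similarities). For $B\subseteq\mathbb R^d$ and $k\in\mathbb N_0=\mathbb N\cup\{0\}$ put $\mathcal S^k(B)=\bigcup_{i\in\mathcal I_{k+1}}f_i(B)$, and for $l\ge k$ put $\mathcal S^{k,l}=\mathcal S^k\circ\cdots\circ\mathcal S^{l-1}$, with $\mathcal S^{k,k}(B)=B$. Assume the (generalised) Moran open-set condition: there exist non-empty open sets $U^k\subset\mathbb R^d$ ($k\in\mathbb N_0$), all contained in one bounded set, and $\epsilon_0>0$ such that (i) $\mathcal S^k(U^{k+1})\subseteq U^k$ for all $k\in\mathbb N_0$; (ii) $f_i(U^k)\cap f_j(U^k)=\emptyset$ for all $k\in\mathbb N$ and all $i,j\in\mathcal I_k$ with $i\ne j$; (iii) the Lebesgue measure of $U^k$ is at least $\epsilon_0$ for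 all $k\in\mathbb N_0$. Let $\{F^k\}_{k\in\mathbb N_0}$ be a pullback attractor of the system: the $F^k$ are compact sets, all contained in one bounded set, $F^k=\mathcal S^k(F^{k+1})$ for all $k$, and for every $k$ and every bounded $B\subset\mathbb R^d$ $$\sup_{x\in\mathcal S^{k,l}(B)}\ \inf_{y\in F^k}|x-y|\to0\quad\text{as } l\to\infty .$$ For a bounded set $A\subset\mathbb R^d$ and $\rho>0$ let $\mathcal N(A,\rho)$ be the minimum number of closed balls of radius $\rho$ with centres in $A$ whose union contains $A$, and let $B_\delta(x)$ be the closed ball of radius $\delta$ centred at $x$. **Theorem.** If $\inf\{\sigma_i:i\in\mathbb N\}>0$ and there exists $s>0$ such that $$\sum_{i\in\mathcal I_k}\sigma_i^s=1\quad\text{for all }k\in\mathbb N,$$ then for every $k\in\mathbb N_0$ the set $F=F^k$ satisfies both of the following. 1. $F$ is equi-homogeneous: for every $\delta_0>0$ there exist $M\ge1$ and $c_1,c_2>0$ such that $$\sup_{x\in F}\mathcal N(B_\delta(x)\cap F,\rho)\le M\inf_{x\in F}\mathcal N(B_{c_1\delta}(x)\cap F,c_2\rho)\quad\text{whenever }0<\rho<\delta\le\delta_0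 .$$ 2. $\dim_{\rm A}F=s$, where the Assouad dimension $\dim_{\rm A}F$ is the infimum of all $t\ge0$ such that for every $\delta_0>0$ there is a constant $C>0$ with $$\sup_{x\in F}\mathcal N(B_\delta(x)\cap F,\rho)\le C(\delta/\rho)^t\quad\text{whenever }0<\rho<\delta\le\delta_0 .$$ -/

import Mathlib

open Set Filter Topology MeasureTheory
open scoped NNReal ENNReal

noncomputable section

/-- `localCover F δ ρ x` is the number `N(B_δ(x) ∩ F, ρ)`: the minimum number of closed `ρ`-balls,
centred in `B_δ(x) ∩ F`, that cover `B_δ(x) ∩ F`, where `B_δ(x)` is a closed ball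
(it is `⊤` if no finite cover exists). It is only used for `δ, ρ > 0`. -/
def localCover {X : Type*} [PseudoMetricSpace X] (F : Set X) (δ ρ : ℝ) (x : X) : ℝ≥0∞ :=
  ((Metric.coveringNumber ρ.toNNReal (Metric.closedBall x δ ∩ F) : ℕ∞) : ℝ≥0∞)

/-- Equi-homogeneous sets. -/
def EquiHomogeneous {X : Type*} [PseudoMetricSpace X] (F : Set X) : Prop :=
  ∀ δ₀ : ℝ, 0 < δ₀ → ∃ M c₁ c₂ : ℝ, 1 ≤ M ∧ 0 < c₁ ∧ 0 < c₂ ∧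
    ∀ δ ρ : ℝ, 0 < ρ → ρ < δ → δ ≤ δ₀ →
      (⨆ x ∈ F, localCover F δ ρ x) ≤
        ENNReal.ofReal M * ⨅ x ∈ F, localCover F (c₁ * δ) (c₂ * ρ) x

/-- The Assouad dimension of a set, as an extended nonnegative real
(it is `⊤` if there is no admissible exponent). -/
def assouadDim {X : Type*} [PseudoMetricSpace X] (F : Set X) : ℝ≥0∞ :=
  ⨅ (t : ℝ≥0) (_ : ∀ δ₀ : ℝ, 0 < δ₀ → ∃ C : ℝ, 0 < C ∧
      ∀ δ ρ : ℝ, 0 < ρ → ρ < δ → δ ≤ δ₀ →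
        (⨆ x ∈ F, localCover F δ ρ x) ≤ ENNReal.ofReal (C * (δ / ρ) ^ (t : ℝ))),
    (t : ℝ≥0∞)

/-- The Hausdorff semi-distance `sup_{x ∈ A} inf_{y ∈ B} |x - y|`. -/
def hausdorffSemidist {X : Type*} [PseudoMetricSpace X] (A B : Set X) : ℝ≥0∞ :=
  ⨆ x ∈ A, ⨅ y ∈ B, edist x y

/-- A non-autonomous iterated function system on `ℝ^d`: contractions `f i` with ratios
`σ i ∈ (0, 1)`, and finite index sets `I k`. Only the index sets `I k` with `k ≥ 1` are used;
`I 0` plays no role. -/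
structure NonautonomousIFS (d : ℕ) where
  f : ℕ → EuclideanSpace ℝ (Fin d) → EuclideanSpace ℝ (Fin d)
  σ : ℕ → ℝ
  σ_pos : ∀ i, 0 < σ i
  σ_lt_one : ∀ i, σ i < 1
  contraction : ∀ i x y, dist (f i x) (f i y) ≤ σ i * dist x y
  I : ℕ → Finset ℕ

namespace NonautonomousIFS

variable {d : ℕ}

/-- All the maps are similarities, with the given ratios. -/
def IsSimilarities (T : NonautonomousIFS d) : Prop :=
  ∀ i x y, dist (T.f i x) (T.f i y) = T.σ i * dist x y

/-- The set map `S^k(B) = ⋃_{i ∈ I_{k+1}} f_i(B)`. -/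
def step (T : NonautonomousIFS d) (k : ℕ) (B : Set (EuclideanSpace ℝ (Fin d))) :
    Set (EuclideanSpace ℝ (Fin d)) :=
  ⋃ i ∈ T.I (k + 1), T.f i '' B

/-- `T.process k n` is `S^{k,k+n} = S^k ∘ S^{k+1} ∘ ⋯ ∘ S^{k+n-1}`. -/
def process (T : NonautonomousIFS d) (k : ℕ) :
    ℕ → Set (EuclideanSpace ℝ (Fin d)) → Set (EuclideanSpace ℝ (Fin d))
  | 0, B => B
  | n + 1, B => T.process k n (T.step (k + n) B)

/-- `F` is a pullback attractor of the system `T`. -/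
structure IsPullbackAttractor (T : NonautonomousIFS d)
    (F : ℕ → Set (EuclideanSpace ℝ (Fin d))) : Prop where
  compact : ∀ k, IsCompact (F k)
  bounded : Bornology.IsBounded (⋃ k, F k)
  invariant : ∀ k, F k = T.step k (F (k + 1))
  attracts : ∀ k, ∀ B : Set (EuclideanSpace ℝ (Fin d)), Bornology.IsBounded B →
    Tendsto (fun n => hausdorffSemidist (T.process k n B) (F k)) atTop (𝓝 0)

/-- The (generalised) Moran open-set condition. -/
def MoranOpenSet (T : NonautonomousIFS d) : Prop :=
  ∃ U : ℕ → Set (EuclideanSpace ℝ (Fin d)),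
    (∀ k, IsOpen (U k) ∧ (U k).Nonempty) ∧
    Bornology.IsBounded (⋃ k, U k) ∧
    (∀ k, T.step k (U (k + 1)) ⊆ U k) ∧
    (∀ k, 1 ≤ k → ∀ i ∈ T.I k, ∀ j ∈ T.I k, i ≠ j →
      Disjoint (T.f i '' U k) (T.f j '' U k)) ∧
    ∃ ε₀ : ℝ, 0 < ε₀ ∧ ∀ k, ENNReal.ofReal ε₀ ≤ volume (U k)

end NonautonomousIFS

end

/-!
The sets `F k` are `s`-homogeneous at all scales, uniformly in the point: for `0 < ρ < δ ≤ δ₀` and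
`x ∈ F k`, the number of `ρ`-balls needed to cover the part of `F k` in the `δ`-ball about `x` lies
between `c * (δ / ρ) ^ s` and `C * (δ / ρ) ^ s`. Equi-homogeneity, with `c₁ = c₂ = 1`, and the value
of the Assouad dimension are immediate from these two bounds
(`equiHomogeneous_of_localCover_bounds`, `assouadDim_eq_of_localCover_bounds`).

The bounds come from cutting `F k` into pieces of one size. Composing the maps along words and
stopping when the product of the ratios falls below `r` gives a `Subdivision`: finitely many similar
copies of sets `F l`, of ratios between `a * r` and `r` with `a = ⨅ i, T.σ i`, whose `s`-th powers
still sum to one (`NonautonomousIFS.nonempty_subdivision`). There are therefore about `r ^ (-s)`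
pieces. The images of the open sets under the same maps are disjoint and have volume at least of
order `r ^ d`, so a ball of radius of order `r` meets only boundedly many pieces
(`Subdivision.exists_boundedOverlap`).

For the upper bound, the `δ`-ball meets boundedly many pieces of size `δ`, each of which is
subdivided into about `(δ / ρ) ^ s` pieces of size `ρ` (`exists_localCover_le`). For the lower bound,
the `δ`-ball contains a piece of size `δ`, hence about `(δ / ρ) ^ s` pieces of size `ρ`, and each
`ρ`-ball meets boundedly many of them (`exists_le_localCover`).
-/

/-! ### Volume of similar copies -/

/-- A similarity of ratio `τ` expands volume by at least `τ ^ d`. The comparison is made for the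
`d`-dimensional Hausdorff measure, where it needs only the antilipschitz bound, and transferred to
Lebesgue measure by uniqueness of Haar measure. -/
lemma ofReal_pow_mul_volume_le_volume_image {d : ℕ}
    {g : EuclideanSpace ℝ (Fin d) → EuclideanSpace ℝ (Fin d)} {τ : ℝ} (hτ : 0 < τ)
    (hg : ∀ x y, dist (g x) (g y) = τ * dist x y) (A : Set (EuclideanSpace ℝ (Fin d))) :
    ENNReal.ofReal (τ ^ d) * volume A ≤ volume (g '' A) := by
  have hanti : AntilipschitzWith (τ⁻¹).toNNReal g := by
    refine AntilipschitzWith.of_le_mul_dist fun x y => ?_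
    rw [Real.coe_toNNReal _ (inv_nonneg.2 hτ.le), hg, inv_mul_cancel_left₀ hτ.ne']
  set H : Measure (EuclideanSpace ℝ (Fin d)) :=
    Measure.hausdorffMeasure (Module.finrank ℝ (EuclideanSpace ℝ (Fin d)) : ℝ) with hH
  have hvol : (volume : Measure (EuclideanSpace ℝ (Fin d))) =
      Measure.addHaarScalarFactor volume H • H :=
    Measure.isAddLeftInvariant_eq_smul _ _
  have key : ENNReal.ofReal (τ ^ d) * H A ≤ H (g '' A) := by
    have h := hanti.le_hausdorffMeasure_image
      (d := (Module.finrank ℝ (EuclideanSpace ℝ (Fin d)) : ℝ)) (Nat.cast_nonneg _) A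
    rw [← hH, ENNReal.rpow_natCast, finrank_euclideanSpace_fin] at h
    calc ENNReal.ofReal (τ ^ d) * H A
        ≤ ENNReal.ofReal (τ ^ d) * ((((τ⁻¹).toNNReal : ℝ≥0) : ℝ≥0∞) ^ d * H (g '' A)) := by
          gcongr
      _ = H (g '' A) := by
          have : ENNReal.ofReal (τ ^ d) * (((τ⁻¹).toNNReal : ℝ≥0) : ℝ≥0∞) ^ d = 1 := by
            change _ * (ENNReal.ofReal τ⁻¹) ^ d = 1
            rw [← ENNReal.ofReal_pow (inv_nonneg.2 hτ.le), ← ENNReal.ofReal_mul (by positivity),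
              ← mul_pow, mul_inv_cancel₀ hτ.ne', one_pow, ENNReal.ofReal_one]
          rw [← mul_assoc, this, one_mul]
  rw [hvol]
  simp only [Measure.smul_apply, ENNReal.smul_def, smul_eq_mul]
  calc _ = (Measure.addHaarScalarFactor volume H : ℝ≥0∞) * (ENNReal.ofReal (τ ^ d) * H A) := by
        ring
    _ ≤ _ := by gcongr

/-! ### Subdivisions at a given scale -/

/-- A subdivision of `F k` at scale `r`: finitely many similar copies `map b '' F (level b)` with
union `F k`, whose ratios are comparable to `r` and have `s`-th powers summing to one, and such
that the corresponding copies of the sets `U (level b)` are disjoint subsets of `U k`. It stands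
for a cut set of finite words in the symbols of an iterated function system, `map b` being the
composition along the word `b`. -/
structure Subdivision {d : ℕ} (F U : ℕ → Set (EuclideanSpace ℝ (Fin d))) (s a : ℝ) (k : ℕ)
    (r : ℝ) where
  ι : Type
  fintype : Fintype ι
  map : ι → EuclideanSpace ℝ (Fin d) → EuclideanSpace ℝ (Fin d)
  level : ι → ℕ
  ratio : ι → ℝ
  dist_map : ∀ b x y, dist (map b x) (map b y) = ratio b * dist x y
  le_ratio : ∀ b, a * r ≤ ratio b
  ratio_le : ∀ b, ratio b ≤ r
  sum_ratio_rpow : ∑ b, ratio b ^ s = 1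
  eq_iUnion : F k = ⋃ b, map b '' F (level b)
  image_subset : ∀ b, map b '' U (level b) ⊆ U k
  pairwise_disjoint : Pairwise fun b c => Disjoint (map b '' U (level b)) (map c '' U (level c))

attribute [instance] Subdivision.fintype

/-- The trivial subdivision into a single copy, of ratio one. -/
def Subdivision.refl {d : ℕ} (F U : ℕ → Set (EuclideanSpace ℝ (Fin d))) (s : ℝ) {a r : ℝ} (k : ℕ)
    (har : a * r ≤ 1) (hr : 1 ≤ r) : Subdivision F U s a k r where
  ι := Unit
  fintype := inferInstance
  map _ := id
  level _ := k
  ratio _ := 1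
  dist_map := by simp
  le_ratio _ := har
  ratio_le _ := hr
  sum_ratio_rpow := by simp
  eq_iUnion := by simp [iUnion_const]
  image_subset := by simp
  pairwise_disjoint b c h := (h (Subsingleton.elim b c)).elim

namespace NonautonomousIFS

variable {d : ℕ}

/-- Subdividing each first-level copy of an invariant family gives a subdivision at a finer
scale. -/
lemma nonempty_subdivision_of_step (T : NonautonomousIFS d) (hsim : T.IsSimilarities)
    {F U : ℕ → Set (EuclideanSpace ℝ (Fin d))} {s a r : ℝ} {k : ℕ}
    (ha : 0 ≤ a) (hr : 0 ≤ r) (hF : F k = T.step k (F (k + 1))) (hU : T.step k (U (k + 1)) ⊆ U k)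
    (hdisj : ∀ i ∈ T.I (k + 1), ∀ j ∈ T.I (k + 1), i ≠ j →
      Disjoint (T.f i '' U (k + 1)) (T.f j '' U (k + 1)))
    (hsum : ∑ i ∈ T.I (k + 1), T.σ i ^ s = 1)
    (P : ∀ i ∈ T.I (k + 1), Nonempty (Subdivision F U s a (k + 1) (r / T.σ i))) :
    Nonempty (Subdivision F U s a k r) := by
  let P' : ∀ i : T.I (k + 1), Subdivision F U s a (k + 1) (r / T.σ i) :=
    fun i => (P i i.2).some
  have hdiv : ∀ i, T.σ i * (r / T.σ i) = r := fun i => mul_div_cancel₀ r (T.σ_pos i).ne'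
  have hle : ∀ (i : T.I (k + 1)) b, a * r ≤ T.σ i * (P' i).ratio b := fun i b => by
    have := mul_le_mul_of_nonneg_left ((P' i).le_ratio b) (T.σ_pos i).le
    rwa [mul_left_comm, hdiv] at this
  have hnonneg : ∀ (i : T.I (k + 1)) b, 0 ≤ (P' i).ratio b := fun i b =>
    (mul_nonneg ha (div_nonneg hr (T.σ_pos i).le)).trans ((P' i).le_ratio b)
  have hinj : ∀ i, Function.Injective (T.f i) := fun i x y h => by
    have := hsim i x y
    rw [h, dist_self, zero_eq_mul] at this
    exact dist_eq_zero.1 (this.resolve_left (T.σ_pos i).ne')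
  refine ⟨{
    ι := Σ i : T.I (k + 1), (P' i).ι
    fintype := inferInstance
    map := fun b => T.f b.1 ∘ (P' b.1).map b.2
    level := fun b => (P' b.1).level b.2
    ratio := fun b => T.σ b.1 * (P' b.1).ratio b.2
    dist_map := fun b x y => by
      simp only [Function.comp_apply]
      rw [hsim, (P' b.1).dist_map, mul_assoc]
    le_ratio := fun b => hle b.1 b.2
    ratio_le := fun b => by
      have := mul_le_mul_of_nonneg_left ((P' b.1).ratio_le b.2) (T.σ_pos b.1).le
      rwa [hdiv] at this
    sum_ratio_rpow := ?_
    eq_iUnion := ?_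
    image_subset := ?_
    pairwise_disjoint := ?_ }⟩
  · rw [Fintype.sum_sigma, ← hsum, ← Finset.sum_coe_sort (T.I (k + 1)) fun i => T.σ i ^ s]
    refine Finset.sum_congr rfl fun i _ => ?_
    simp only [Real.mul_rpow (T.σ_pos i).le (hnonneg i _)]
    rw [← Finset.mul_sum, (P' i).sum_ratio_rpow, mul_one]
  · rw [iUnion_sigma, hF, step]
    refine (biUnion_eq_iUnion _ fun i _ => T.f i '' F (k + 1)).trans ?_
    refine iUnion_congr fun i => ?_
    conv_lhs => rw [(P' i).eq_iUnion]
    simp only [image_iUnion, image_comp]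
  · intro b
    rw [image_comp]
    refine Subset.trans ?_ hU
    refine (image_mono ((P' b.1).image_subset b.2)).trans ?_
    exact subset_biUnion_of_mem (u := fun i => T.f i '' U (k + 1)) b.1.2
  · rintro ⟨i, b⟩ ⟨j, c⟩ hne
    simp only [image_comp]
    by_cases hij : i = j
    · subst hij
      refine (disjoint_image_iff (hinj i)).2 ((P' i).pairwise_disjoint fun h => hne ?_)
      rw [h]
    · exact (hdisj i i.2 j j.2 fun h => hij (Subtype.ext h)).mono
        (image_mono ((P' i).image_subset b)) (image_mono ((P' j).image_subset c))

/-- The hypothesis that the `s`-th powers of the ratios sum to one at each level forces each index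
set to have two elements, so that the ratios in use are bounded away from one. -/
lemma exists_ratio_le_of_sum_rpow_eq_one (T : NonautonomousIFS d) {s a : ℝ} (hs : 0 < s)
    (ha : 0 < a) (haσ : ∀ i, a ≤ T.σ i) (hsum : ∀ k, 1 ≤ k → ∑ i ∈ T.I k, T.σ i ^ s = 1) :
    ∃ q : ℝ, 0 ≤ q ∧ q < 1 ∧ ∀ k, ∀ i ∈ T.I (k + 1), T.σ i ≤ q := by
  have ha1 : a < 1 := (haσ 0).trans_lt (T.σ_lt_one 0)
  have has0 : 0 < a ^ s := Real.rpow_pos_of_pos ha s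
  have has1 : a ^ s < 1 := Real.rpow_lt_one ha.le ha1 hs
  refine ⟨(1 - a ^ s) ^ s⁻¹, Real.rpow_nonneg (by linarith) _,
    Real.rpow_lt_one (by linarith) (by linarith) (inv_pos.2 hs), fun k i hi => ?_⟩
  have hσs : T.σ i ^ s < 1 := Real.rpow_lt_one (T.σ_pos i).le (T.σ_lt_one i) hs
  have hsplit := Finset.add_sum_erase (T.I (k + 1)) (fun i => T.σ i ^ s) hi
  simp only [hsum (k + 1) (Nat.le_add_left 1 k)] at hsplit
  obtain ⟨j, hj⟩ : ((T.I (k + 1)).erase i).Nonempty := by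
    rw [Finset.nonempty_iff_ne_empty]
    intro h
    rw [h, Finset.sum_empty] at hsplit
    linarith
  have hj' : T.σ j ^ s ≤ ∑ i ∈ (T.I (k + 1)).erase i, T.σ i ^ s :=
    Finset.single_le_sum (f := fun i => T.σ i ^ s)
      (fun i _ => Real.rpow_nonneg (T.σ_pos i).le s) hj
  have haj : a ^ s ≤ T.σ j ^ s := Real.rpow_le_rpow ha.le (haσ j) hs.le
  rw [Real.le_rpow_inv_iff_of_pos (T.σ_pos i).le (by linarith) hs]
  linarith

/-- An invariant family with the open set condition has subdivisions at every scale up to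
`1 / a`, where `a` is a lower bound of the ratios. -/
lemma nonempty_subdivision (T : NonautonomousIFS d) (hsim : T.IsSimilarities)
    {F U : ℕ → Set (EuclideanSpace ℝ (Fin d))} {s a : ℝ} (hs : 0 < s) (ha : 0 < a)
    (haσ : ∀ i, a ≤ T.σ i) (hF : ∀ k, F k = T.step k (F (k + 1)))
    (hU : ∀ k, T.step k (U (k + 1)) ⊆ U k)
    (hdisj : ∀ k, 1 ≤ k → ∀ i ∈ T.I k, ∀ j ∈ T.I k, i ≠ j →
      Disjoint (T.f i '' U k) (T.f j '' U k))
    (hsum : ∀ k, 1 ≤ k → ∑ i ∈ T.I k, T.σ i ^ s = 1) (k : ℕ) {r : ℝ} (hr : 0 < r)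
    (har : a * r ≤ 1) : Nonempty (Subdivision F U s a k r) := by
  obtain ⟨q, hq0, hq1, hq⟩ := T.exists_ratio_le_of_sum_rpow_eq_one hs ha haσ hsum
  obtain ⟨m, hm⟩ := exists_pow_lt_of_lt_one hr hq1
  -- Passing to the next level divides the scale by a ratio, which is at most `q`, so the scale
  -- exceeds one after `m` levels.
  replace hm := hm.le
  induction m generalizing k r with
  | zero => exact ⟨Subdivision.refl F U s k har (by simpa using hm)⟩
  | succ m ih =>
    rcases le_or_gt 1 r with h1 | h1
    · exact ⟨Subdivision.refl F U s k har h1⟩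
    refine T.nonempty_subdivision_of_step hsim ha.le hr.le (hF k) (hU k)
      (hdisj _ (Nat.le_add_left 1 k)) (hsum _ (Nat.le_add_left 1 k)) fun i hi => ?_
    refine ih (k + 1) (div_pos hr (T.σ_pos i)) ?_ ?_
    · rw [mul_div_assoc', div_le_one (T.σ_pos i)]
      nlinarith [haσ i]
    · rw [le_div_iff₀ (T.σ_pos i)]
      calc q ^ m * T.σ i ≤ q ^ m * q := by gcongr; exact hq k i hi
        _ ≤ r := by rwa [← pow_succ]

end NonautonomousIFS

/-! ### Counting the pieces of a subdivision -/

/-- At most `N` pieces of any subdivision at scale `r` meet a given closed ball of radius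
`K * r`; neither the scale nor the ball enters the bound. -/
def BoundedOverlap {d : ℕ} (F U : ℕ → Set (EuclideanSpace ℝ (Fin d))) (s a K : ℝ) (N : ℕ) :
    Prop :=
  ∀ (k : ℕ) (r : ℝ) (P : Subdivision F U s a k r), 0 < r →
    ∀ (x : EuclideanSpace ℝ (Fin d)) (A : Finset P.ι),
      (∀ b ∈ A, ∃ y ∈ F (P.level b), dist (P.map b y) x ≤ K * r) → A.card ≤ N

namespace Subdivision

variable {d : ℕ} {F U : ℕ → Set (EuclideanSpace ℝ (Fin d))} {s a r : ℝ} {k : ℕ}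

lemma ratio_pos (P : Subdivision F U s a k r) (ha : 0 < a) (hr : 0 < r) (b : P.ι) :
    0 < P.ratio b :=
  (mul_pos ha hr).trans_le (P.le_ratio b)

lemma rpow_neg_le_card (P : Subdivision F U s a k r) (hs : 0 < s) (ha : 0 < a) (hr : 0 < r) :
    r ^ (-s) ≤ Fintype.card P.ι := by
  have h : ∑ b, P.ratio b ^ s ≤ ∑ _b : P.ι, r ^ s := Finset.sum_le_sum fun b _ =>
    Real.rpow_le_rpow (P.ratio_pos ha hr b).le (P.ratio_le b) hs.le
  rw [P.sum_ratio_rpow, Finset.sum_const, Finset.card_univ, nsmul_eq_mul] at h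
  rw [Real.rpow_neg hr.le]
  exact (inv_le_iff_one_le_mul₀ (Real.rpow_pos_of_pos hr s)).2 h

lemma card_le_rpow_neg (P : Subdivision F U s a k r) (hs : 0 < s) (ha : 0 < a) (hr : 0 < r) :
    (Fintype.card P.ι : ℝ) ≤ (a * r) ^ (-s) := by
  have har := mul_pos ha hr
  have h : ∑ _b : P.ι, (a * r) ^ s ≤ ∑ b, P.ratio b ^ s := Finset.sum_le_sum fun b _ =>
    Real.rpow_le_rpow har.le (P.le_ratio b) hs.le
  rw [P.sum_ratio_rpow, Finset.sum_const, Finset.card_univ, nsmul_eq_mul] at h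
  rw [Real.rpow_neg har.le]
  rwa [← one_div, le_div_iff₀ (Real.rpow_pos_of_pos har s)]

/-- The volume argument: the number of pieces of a subdivision at scale `r` that meet a ball of
radius `K * r` is bounded by a constant, since the corresponding copies of the sets `U` are
disjoint, have volume at least of order `r ^ d`, and lie in a ball of radius of order `r`. -/
lemma exists_boundedOverlap {ε₀ D : ℝ} (ha : 0 < a) (hε : 0 < ε₀) (hD : 0 ≤ D)
    (hUo : ∀ k, IsOpen (U k)) (hUv : ∀ k, ENNReal.ofReal ε₀ ≤ volume (U k))
    (hFU : ∀ k, ∀ x ∈ F k, ∀ y ∈ U k, dist y x ≤ D) {K : ℝ} (hK : 0 ≤ K) :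
    ∃ N : ℕ, BoundedOverlap F U s a K N := by
  set V := volume (Metric.closedBall (0 : EuclideanSpace ℝ (Fin d)) 1)
  have hVtop : V ≠ ⊤ := measure_closedBall_lt_top.ne
  refine ⟨⌈(K + D) ^ d * V.toReal / (a ^ d * ε₀)⌉₊, fun k r P hr x A hA => ?_⟩
  have hsub : ⋃ b ∈ A, P.map b '' U (P.level b) ⊆ Metric.closedBall x ((K + D) * r) := by
    refine iUnion₂_subset fun b hb => ?_
    rintro _ ⟨u, hu, rfl⟩
    obtain ⟨y, hy, hyx⟩ := hA b hb
    have h1 : dist (P.map b u) (P.map b y) ≤ r * D := by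
      rw [P.dist_map]
      exact mul_le_mul (P.ratio_le b) (hFU _ y hy u hu) dist_nonneg hr.le
    have := dist_triangle (P.map b u) (P.map b y) x
    rw [Metric.mem_closedBall]
    linarith
  have hmeas : ∀ b ∈ A, MeasurableSet (P.map b '' U (P.level b)) := fun b _ => by
    have hlip : LipschitzWith (P.ratio b).toNNReal (P.map b) :=
      LipschitzWith.of_dist_le_mul fun x y => by
        rw [Real.coe_toNNReal _ (P.ratio_pos ha hr b).le, P.dist_map]
    refine (hUo _).measurableSet.image_of_continuousOn_injOn hlip.continuous.continuousOn
      fun x _ y _ h => ?_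
    have := P.dist_map b x y
    rw [h, dist_self, zero_eq_mul] at this
    exact dist_eq_zero.1 (this.resolve_left (P.ratio_pos ha hr b).ne')
  have hvol : ∀ b ∈ A, ENNReal.ofReal ((a * r) ^ d * ε₀) ≤ volume (P.map b '' U (P.level b)) :=
    fun b _ => by
      refine le_trans ?_ (ofReal_pow_mul_volume_le_volume_image (P.ratio_pos ha hr b)
        (P.dist_map b) (U (P.level b)))
      rw [ENNReal.ofReal_mul (by positivity)]
      gcongr
      · exact P.le_ratio b
      · exact hUv _
  have htot : (A.card : ℝ≥0∞) * ENNReal.ofReal ((a * r) ^ d * ε₀) ≤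
      ENNReal.ofReal (((K + D) * r) ^ d) * V := by
    calc (A.card : ℝ≥0∞) * ENNReal.ofReal ((a * r) ^ d * ε₀)
        = ∑ b ∈ A, ENNReal.ofReal ((a * r) ^ d * ε₀) := by
          rw [Finset.sum_const, nsmul_eq_mul]
      _ ≤ ∑ b ∈ A, volume (P.map b '' U (P.level b)) := Finset.sum_le_sum hvol
      _ = volume (⋃ b ∈ A, P.map b '' U (P.level b)) :=
          (measure_biUnion_finset (fun b _ c _ h => P.pairwise_disjoint h) hmeas).symm
      _ ≤ volume (Metric.closedBall x ((K + D) * r)) := measure_mono hsub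
      _ = ENNReal.ofReal (((K + D) * r) ^ d) * V := by
          rw [Measure.addHaar_closedBall' _ _ (by positivity), finrank_euclideanSpace_fin]
  have hreal : (A.card : ℝ) * ((a * r) ^ d * ε₀) ≤ ((K + D) * r) ^ d * V.toReal := by
    have := ENNReal.toReal_mono (ENNReal.mul_ne_top ENNReal.ofReal_ne_top hVtop) htot
    rwa [ENNReal.toReal_mul, ENNReal.toReal_mul, ENNReal.toReal_natCast,
      ENNReal.toReal_ofReal (by positivity), ENNReal.toReal_ofReal (by positivity)] at this
  refine Nat.cast_le.1 (le_trans ?_ (Nat.le_ceil _))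
  rw [le_div_iff₀ (by positivity)]
  refine le_of_mul_le_mul_right ?_ (pow_pos hr d)
  rw [mul_pow, mul_pow] at hreal
  linarith

/-- Sets of diameter of order `r` that cover `F k` are at least of order `r ^ (-s)` in number:
by the bounded overlap, each of them meets a bounded number of pieces at scale `r`. -/
lemma rpow_neg_le_mul_card_of_cover (P : Subdivision F U s a k r) (hs : 0 < s) (ha : 0 < a)
    (hr : 0 < r) (hne : ∀ k, (F k).Nonempty) {K : ℝ} {N : ℕ}
    (hN : BoundedOverlap F U s a K N)
    {γ : Type*} (C : Finset γ) (t : γ → Set (EuclideanSpace ℝ (Fin d)))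
    (hcover : F k ⊆ ⋃ c ∈ C, t c) (ht : ∀ c ∈ C, ∀ x ∈ t c, ∀ y ∈ t c, dist x y ≤ K * r) :
    r ^ (-s) ≤ N * C.card := by
  classical
  choose p hp using fun b => hne (P.level b)
  have hpF : ∀ b, P.map b (p b) ∈ F k := fun b => by
    rw [P.eq_iUnion]
    exact mem_iUnion_of_mem b (mem_image_of_mem _ (hp b))
  have hc : ∀ b, ∃ c ∈ C, P.map b (p b) ∈ t c := fun b => by
    simpa only [mem_iUnion₂, exists_prop] using hcover (hpF b)
  choose c hcC hct using hc
  have hfib : ∀ e ∈ Finset.univ.image c, (Finset.univ.filter fun b => c b = e).card ≤ N := by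
    intro e he
    obtain ⟨b, -, rfl⟩ := Finset.mem_image.1 he
    refine hN k r P hr (P.map b (p b)) _ fun b' hb' => ⟨p b', hp b', ?_⟩
    have hbb : c b' = c b := (Finset.mem_filter.1 hb').2
    exact ht (c b) (hcC b) _ (hbb ▸ hct b') _ (hct b)
  have hcard : Fintype.card P.ι ≤ N * C.card := by
    refine (Finset.card_le_mul_card_image Finset.univ N hfib).trans ?_
    gcongr
    exact Finset.image_subset_iff.2 fun b _ => hcC b
  exact (P.rpow_neg_le_card hs ha hr).trans (mod_cast hcard)

end Subdivision

/-! ### Bounds for the local covering numbers -/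

/-- Passing from a cover by sets of diameter at most `ρ` to a cover by balls of radius `ρ` centred
in the covered set. -/
lemma coveringNumber_le_card_of_cover {X γ : Type*} [PseudoMetricSpace X] {A : Set X} {ρ : ℝ}
    (hρ : 0 ≤ ρ) (C : Finset γ) (t : γ → Set X) (hcover : A ⊆ ⋃ c ∈ C, t c)
    (ht : ∀ c ∈ C, ∀ x ∈ t c, ∀ y ∈ t c, dist x y ≤ ρ) :
    Metric.coveringNumber ρ.toNNReal A ≤ C.card := by
  classical
  rcases A.eq_empty_or_nonempty with rfl | ⟨x₀, hx₀⟩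
  · simp
  have hp : ∀ c, ∃ p ∈ A, (t c ∩ A).Nonempty → p ∈ t c := fun c => by
    by_cases h : (t c ∩ A).Nonempty
    · exact ⟨h.some, h.some_mem.2, fun _ => h.some_mem.1⟩
    · exact ⟨x₀, hx₀, fun h' => (h h').elim⟩
  choose p hpA hpt using hp
  have hsub : ((C.image p : Finset X) : Set X) ⊆ A := by
    intro y hy
    obtain ⟨c, -, rfl⟩ := Finset.mem_image.1 (Finset.mem_coe.1 hy)
    exact hpA c
  have hcov : Metric.IsCover ρ.toNNReal A (C.image p : Finset X) := by
    rw [Metric.isCover_iff_subset_iUnion_closedBall]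
    intro y hy
    obtain ⟨c, hcC, hyc⟩ := mem_iUnion₂.1 (hcover hy)
    refine mem_iUnion₂.2 ⟨p c, Finset.mem_coe.2 (Finset.mem_image_of_mem p hcC), ?_⟩
    rw [Metric.mem_closedBall, Real.coe_toNNReal _ hρ]
    exact ht c hcC y hyc (p c) (hpt c ⟨y, hyc, hy⟩)
  refine (hcov.coveringNumber_le_encard hsub).trans ?_
  rw [encard_coe_eq_coe_finsetCard]
  exact_mod_cast Finset.card_image_le

/-- To bound a covering number from below it suffices to bound the size of every finite cover. -/
lemma ofReal_le_coveringNumber {X : Type*} [PseudoMetricSpace X] {A : Set X} {ρ B : ℝ}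
    (hρ : 0 ≤ ρ)
    (h : ∀ C : Finset X, A ⊆ ⋃ c ∈ C, Metric.closedBall c ρ → B ≤ C.card) :
    ENNReal.ofReal B ≤ ((Metric.coveringNumber ρ.toNNReal A : ℕ∞) : ℝ≥0∞) := by
  by_cases htop : Metric.coveringNumber ρ.toNNReal A = ⊤
  · simp [htop]
  obtain ⟨C, hCA, hfin, hcov, hcard⟩ := Metric.exists_set_encard_eq_coveringNumber htop
  lift C to Finset X using hfin
  rw [← hcard, encard_coe_eq_coe_finsetCard]
  rw [Metric.isCover_iff_subset_iUnion_closedBall, Real.coe_toNNReal _ hρ] at hcov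
  have := ENNReal.ofReal_le_ofReal (h C (by simpa only [Finset.mem_coe] using hcov))
  simpa using this

section Bounds

variable {d : ℕ} {F U : ℕ → Set (EuclideanSpace ℝ (Fin d))} {s a D : ℝ}

/-- The ball of radius `δ` meets a bounded number of pieces at scale of order `δ`, and each of
these is subdivided into at most of order `(δ / ρ) ^ s` pieces of diameter at most `ρ`. -/
lemma exists_localCover_le (hs : 0 < s) (ha : 0 < a) (ha1 : a ≤ 1) (hD : 0 < D)
    (hsub : ∀ k r, 0 < r → a * r ≤ 1 → Nonempty (Subdivision F U s a k r))
    (hFD : ∀ k, ∀ x ∈ F k, ∀ y ∈ F k, dist x y ≤ D)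
    (hN : ∀ K : ℝ, 0 ≤ K → ∃ N : ℕ, BoundedOverlap F U s a K N)
    (k : ℕ) {δ₀ : ℝ} (hδ₀ : 0 < δ₀) :
    ∃ C : ℝ, 0 < C ∧ ∀ δ ρ : ℝ, 0 < ρ → ρ < δ → δ ≤ δ₀ → ∀ x ∈ F k,
      localCover (F k) δ ρ x ≤ ENNReal.ofReal (C * (δ / ρ) ^ s) := by
  classical
  -- The factor `m` makes both `m * δ ≤ 1` and the diameters `D * (m * δ) * (ρ / δ)` at most `ρ`.
  obtain ⟨m, hm, hmD, hmδ⟩ : ∃ m : ℝ, 0 < m ∧ D * m ≤ 1 ∧ m * δ₀ ≤ 1 :=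
    ⟨min D⁻¹ δ₀⁻¹, lt_min (inv_pos.2 hD) (inv_pos.2 hδ₀),
      (mul_le_mul_of_nonneg_left (min_le_left _ _) hD.le).trans_eq (mul_inv_cancel₀ hD.ne'),
      (mul_le_mul_of_nonneg_right (min_le_right _ _) hδ₀.le).trans_eq (inv_mul_cancel₀ hδ₀.ne')⟩
  obtain ⟨N, hN⟩ := hN m⁻¹ (inv_nonneg.2 hm.le)
  refine ⟨(N + 1) * a ^ (-s), by positivity, fun δ ρ hρ hρδ hδ x _ => ?_⟩
  have hδ0 := hρ.trans hρδ
  have hr1 : 0 < m * δ := mul_pos hm hδ0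
  have hr2 : 0 < ρ / δ := div_pos hρ hδ0
  have hr2' : ρ / δ ≤ 1 := (div_le_one hδ0).2 hρδ.le
  have hmδ' : m * δ ≤ 1 := (mul_le_mul_of_nonneg_left hδ hm.le).trans hmδ
  obtain ⟨P⟩ := hsub k (m * δ) hr1 (mul_le_one₀ ha1 hr1.le hmδ')
  have Q : ∀ b, Subdivision F U s a (P.level b) (ρ / δ) := fun b =>
    (hsub (P.level b) (ρ / δ) hr2 (mul_le_one₀ ha1 hr2.le hr2')).some
  let A : Finset P.ι := Finset.univ.filter fun b => ∃ y ∈ F (P.level b), dist (P.map b y) x ≤ δ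
  have hA : A.card ≤ N := hN _ _ P hr1 x A fun b hb => by
    rw [inv_mul_cancel_left₀ hm.ne']
    exact (Finset.mem_filter.1 hb).2
  let C : Finset (Σ b, (Q b).ι) := A.sigma fun _ => Finset.univ
  have hC : (C.card : ℝ) ≤ (N + 1) * a ^ (-s) * (δ / ρ) ^ s := by
    have hpow : (a * (ρ / δ)) ^ (-s) = a ^ (-s) * (δ / ρ) ^ s := by
      rw [Real.mul_rpow ha.le hr2.le, Real.rpow_neg hr2.le, ← Real.inv_rpow hr2.le, inv_div]
    have h1 : (C.card : ℝ) ≤ A.card * (a * (ρ / δ)) ^ (-s) := by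
      rw [Finset.card_sigma, Nat.cast_sum, ← nsmul_eq_mul]
      exact Finset.sum_le_card_nsmul _ _ _ fun b _ => (Q b).card_le_rpow_neg hs ha hr2
    rw [mul_assoc, ← hpow]
    refine h1.trans ?_
    gcongr
    exact (Nat.cast_le.2 hA).trans (le_add_of_nonneg_right zero_le_one)
  have hcov : Metric.coveringNumber ρ.toNNReal (Metric.closedBall x δ ∩ F k) ≤ C.card := by
    refine coveringNumber_le_card_of_cover hρ.le C
      (fun c => P.map c.1 '' ((Q c.1).map c.2 '' F ((Q c.1).level c.2))) ?_ ?_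
    · rintro z ⟨hz, hzF⟩
      rw [P.eq_iUnion] at hzF
      obtain ⟨b, y, hy, rfl⟩ := mem_iUnion.1 hzF
      have hbA : b ∈ A := Finset.mem_filter.2 ⟨Finset.mem_univ b, y, hy, hz⟩
      rw [(Q b).eq_iUnion] at hy
      obtain ⟨c, hc⟩ := mem_iUnion.1 hy
      exact mem_iUnion₂.2 ⟨⟨b, c⟩, Finset.mem_sigma.2 ⟨hbA, Finset.mem_univ c⟩,
        mem_image_of_mem _ hc⟩
    · rintro ⟨b, c⟩ - _ ⟨_, ⟨u, hu, rfl⟩, rfl⟩ _ ⟨_, ⟨v, hv, rfl⟩, rfl⟩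
      rw [P.dist_map, (Q b).dist_map]
      calc P.ratio b * ((Q b).ratio c * dist u v)
          ≤ m * δ * (ρ / δ * D) := by
            gcongr
            · exact mul_nonneg ((Q b).ratio_pos ha hr2 c).le dist_nonneg
            · exact P.ratio_le b
            · exact (Q b).ratio_le c
            · exact hFD _ u hu v hv
        _ = D * m * ρ := by field_simp
        _ ≤ ρ := mul_le_of_le_one_left hρ.le hmD
  calc localCover (F k) δ ρ x ≤ ((C.card : ℕ∞) : ℝ≥0∞) := ENat.toENNReal_le.2 hcov
    _ = ENNReal.ofReal C.card := by simp
    _ ≤ _ := ENNReal.ofReal_le_ofReal hC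

/-- The ball of radius `δ` about a point of `F k` contains a whole piece at scale of order `δ`,
and a cover of this piece by balls of radius `ρ` pulls back to a cover of some `F l` by sets of
diameter of order `ρ / δ`. -/
lemma exists_le_localCover (hs : 0 < s) (ha : 0 < a) (ha1 : a ≤ 1) (hD : 0 < D)
    (hne : ∀ k, (F k).Nonempty)
    (hsub : ∀ k r, 0 < r → a * r ≤ 1 → Nonempty (Subdivision F U s a k r))
    (hFD : ∀ k, ∀ x ∈ F k, ∀ y ∈ F k, dist x y ≤ D)
    (hN : ∀ K : ℝ, 0 ≤ K → ∃ N : ℕ, BoundedOverlap F U s a K N)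
    (k : ℕ) {δ₀ : ℝ} (hδ₀ : 0 < δ₀) :
    ∃ c : ℝ, 0 < c ∧ ∀ δ ρ : ℝ, 0 < ρ → ρ < δ → δ ≤ δ₀ → ∀ x ∈ F k,
      ENNReal.ofReal (c * (δ / ρ) ^ s) ≤ localCover (F k) δ ρ x := by
  -- The factor `m` makes `m * δ ≤ 1` and lets a piece at scale `m * δ` have diameter at most `δ`.
  obtain ⟨m, hm, hmD, hmδ⟩ : ∃ m : ℝ, 0 < m ∧ D * m ≤ 1 ∧ m * δ₀ ≤ 1 :=
    ⟨min D⁻¹ δ₀⁻¹, lt_min (inv_pos.2 hD) (inv_pos.2 hδ₀),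
      (mul_le_mul_of_nonneg_left (min_le_left _ _) hD.le).trans_eq (mul_inv_cancel₀ hD.ne'),
      (mul_le_mul_of_nonneg_right (min_le_right _ _) hδ₀.le).trans_eq (inv_mul_cancel₀ hδ₀.ne')⟩
  -- A ball of radius `ρ` pulls back along a map of ratio at least `a * (m * δ)` to a set of
  -- diameter at most `2 * ρ / (a * (m * δ))`.
  obtain ⟨N, hN⟩ := hN (2 / (a * m)) (by positivity)
  refine ⟨((N : ℝ) + 1)⁻¹, by positivity, fun δ ρ hρ hρδ hδ x hx => ?_⟩
  have hδ0 := hρ.trans hρδ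
  have hr1 : 0 < m * δ := mul_pos hm hδ0
  have hr2 : 0 < ρ / δ := div_pos hρ hδ0
  have hr2' : ρ / δ ≤ 1 := (div_le_one hδ0).2 hρδ.le
  have hmδ' : m * δ ≤ 1 := (mul_le_mul_of_nonneg_left hδ hm.le).trans hmδ
  obtain ⟨P⟩ := hsub k (m * δ) hr1 (mul_le_one₀ ha1 hr1.le hmδ')
  have hPF : ∀ b, P.map b '' F (P.level b) ⊆ F k := fun b => by
    conv_rhs => rw [P.eq_iUnion]
    exact subset_iUnion (fun b => P.map b '' F (P.level b)) b
  obtain ⟨b, u, hu, hux⟩ : ∃ b, ∃ u ∈ F (P.level b), P.map b u = x := by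
    rw [P.eq_iUnion] at hx
    exact mem_iUnion.1 hx
  obtain ⟨Q⟩ := hsub (P.level b) (ρ / δ) hr2 (mul_le_one₀ ha1 hr2.le hr2')
  refine ofReal_le_coveringNumber hρ.le fun C hC => ?_
  have hmem : ∀ v ∈ F (P.level b), P.map b v ∈ Metric.closedBall x δ ∩ F k := fun v hv => by
    refine ⟨?_, hPF b (mem_image_of_mem _ hv)⟩
    rw [Metric.mem_closedBall, ← hux, P.dist_map]
    calc P.ratio b * dist v u ≤ m * δ * D := by
          gcongr
          · exact P.ratio_le b
          · exact hFD _ v hv u hu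
      _ = D * m * δ := by ring
      _ ≤ δ := mul_le_of_le_one_left hδ0.le hmD
  have hQ : (ρ / δ) ^ (-s) ≤ N * C.card := by
    refine Q.rpow_neg_le_mul_card_of_cover hs ha hr2 hne hN C
      (fun c => P.map b ⁻¹' Metric.closedBall c ρ) (fun v hv => ?_) fun c _ v hv w hw => ?_
    · simpa only [mem_iUnion, mem_preimage] using hC (hmem v hv)
    · have h1 : a * (m * δ) * dist v w ≤ 2 * ρ := by
        calc a * (m * δ) * dist v w ≤ P.ratio b * dist v w := by
              gcongr
              exact P.le_ratio b
          _ = dist (P.map b v) (P.map b w) := (P.dist_map b v w).symm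
          _ ≤ dist (P.map b v) c + dist (P.map b w) c := dist_triangle_right _ _ _
          _ ≤ ρ + ρ := add_le_add hv hw
          _ = 2 * ρ := (two_mul ρ).symm
      rw [div_mul_div_comm, le_div_iff₀ (by positivity)]
      linarith
  rw [Real.rpow_neg hr2.le, ← Real.inv_rpow hr2.le, inv_div] at hQ
  rw [inv_mul_le_iff₀ (by positivity)]
  refine hQ.trans ?_
  gcongr
  exact le_add_of_nonneg_right zero_le_one

end Bounds

/-! ### Consequences of two-sided bounds -/

section TwoSided

variable {X : Type*} [PseudoMetricSpace X] {F : Set X} {s : ℝ}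

lemma equiHomogeneous_of_localCover_bounds
    (hupper : ∀ δ₀ : ℝ, 0 < δ₀ → ∃ C : ℝ, 0 < C ∧ ∀ δ ρ : ℝ, 0 < ρ → ρ < δ → δ ≤ δ₀ →
      ∀ x ∈ F, localCover F δ ρ x ≤ ENNReal.ofReal (C * (δ / ρ) ^ s))
    (hlower : ∀ δ₀ : ℝ, 0 < δ₀ → ∃ c : ℝ, 0 < c ∧ ∀ δ ρ : ℝ, 0 < ρ → ρ < δ → δ ≤ δ₀ →
      ∀ x ∈ F, ENNReal.ofReal (c * (δ / ρ) ^ s) ≤ localCover F δ ρ x) :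
    EquiHomogeneous F := by
  intro δ₀ hδ₀
  obtain ⟨C, hC, hupper⟩ := hupper δ₀ hδ₀
  obtain ⟨c, hc, hlower⟩ := hlower δ₀ hδ₀
  have hM : 0 < max 1 (C / c) := lt_max_of_lt_left one_pos
  refine ⟨max 1 (C / c), 1, 1, le_max_left _ _, one_pos, one_pos, fun δ ρ hρ hρδ hδ => ?_⟩
  simp only [one_mul]
  have hpow : 0 ≤ (δ / ρ) ^ s := Real.rpow_nonneg (div_pos (hρ.trans hρδ) hρ).le s
  calc ⨆ x ∈ F, localCover F δ ρ x ≤ ENNReal.ofReal (C * (δ / ρ) ^ s) :=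
        iSup₂_le (hupper δ ρ hρ hρδ hδ)
    _ ≤ ENNReal.ofReal (max 1 (C / c) * (c * (δ / ρ) ^ s)) := by
        refine ENNReal.ofReal_le_ofReal ?_
        rw [← mul_assoc]
        gcongr
        exact (div_le_iff₀ hc).1 (le_max_right _ _)
    _ = ENNReal.ofReal (max 1 (C / c)) * ENNReal.ofReal (c * (δ / ρ) ^ s) :=
        ENNReal.ofReal_mul hM.le
    _ ≤ _ := by
        gcongr
        exact le_iInf₂ (hlower δ ρ hρ hρδ hδ)

lemma assouadDim_eq_of_localCover_bounds (hF : F.Nonempty) (hs : 0 ≤ s)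
    (hupper : ∀ δ₀ : ℝ, 0 < δ₀ → ∃ C : ℝ, 0 < C ∧ ∀ δ ρ : ℝ, 0 < ρ → ρ < δ → δ ≤ δ₀ →
      ∀ x ∈ F, localCover F δ ρ x ≤ ENNReal.ofReal (C * (δ / ρ) ^ s))
    (hlower : ∀ δ₀ : ℝ, 0 < δ₀ → ∃ c : ℝ, 0 < c ∧ ∀ δ ρ : ℝ, 0 < ρ → ρ < δ → δ ≤ δ₀ →
      ∀ x ∈ F, ENNReal.ofReal (c * (δ / ρ) ^ s) ≤ localCover F δ ρ x) :
    assouadDim F = ENNReal.ofReal s := by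
  apply le_antisymm
  · refine iInf₂_le s.toNNReal fun δ₀ hδ₀ => ?_
    obtain ⟨C, hC, hupper⟩ := hupper δ₀ hδ₀
    refine ⟨C, hC, fun δ ρ hρ hρδ hδ => ?_⟩
    rw [Real.coe_toNNReal s hs]
    exact iSup₂_le (hupper δ ρ hρ hρδ hδ)
  · refine le_iInf₂ fun t ht => ?_
    obtain ⟨C, hC, ht⟩ := ht 1 one_pos
    obtain ⟨c, hc, hlower⟩ := hlower 1 one_pos
    obtain ⟨x, hx⟩ := hF
    rw [← ENNReal.ofReal_coe_nnreal]
    refine ENNReal.ofReal_le_ofReal ?_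
    by_contra! hlt
    have hbound : ∀ q : ℝ, 1 < q → q ^ (s - t) ≤ C / c := fun q hq => by
      have hq0 : 0 < q := one_pos.trans hq
      have h := (hlower 1 q⁻¹ (inv_pos.2 hq0) (inv_lt_one_of_one_lt₀ hq) le_rfl x hx).trans
        ((le_iSup₂ (f := fun x _ => localCover F 1 q⁻¹ x) x hx).trans
          (ht 1 q⁻¹ (inv_pos.2 hq0) (inv_lt_one_of_one_lt₀ hq) le_rfl))
      rw [one_div, inv_inv, ENNReal.ofReal_le_ofReal_iff (by positivity)] at h
      rw [Real.rpow_sub hq0, div_le_div_iff₀ (Real.rpow_pos_of_pos hq0 _) hc]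
      linarith
    obtain ⟨q, hq, hq1⟩ := ((tendsto_rpow_atTop (sub_pos.2 hlt)).eventually_gt_atTop (C / c)
      |>.and (eventually_gt_atTop 1)).exists
    exact (hbound q hq1).not_gt hq

end TwoSided

/-! ### Pullback attractors -/

/-- The attraction property rules out empty fibres: the distance from a non-empty set to the empty
set is infinite. -/
lemma NonautonomousIFS.IsPullbackAttractor.nonempty {d : ℕ} {T : NonautonomousIFS d}
    {F : ℕ → Set (EuclideanSpace ℝ (Fin d))} (hF : T.IsPullbackAttractor F)
    (hI : ∀ k, (T.I (k + 1)).Nonempty) (k : ℕ) : (F k).Nonempty := by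
  have hstep : ∀ k B, B.Nonempty → (T.step k B).Nonempty := fun k B hB => by
    obtain ⟨i, hi⟩ := hI k
    exact (hB.image (T.f i)).mono (subset_biUnion_of_mem (u := fun i => T.f i '' B) hi)
  have hproc : ∀ n B, B.Nonempty → (T.process k n B).Nonempty := by
    intro n
    induction n with
    | zero => exact fun B hB => hB
    | succ n ih => exact fun B hB => ih _ (hstep _ _ hB)
  by_contra hempty
  rw [not_nonempty_iff_eq_empty] at hempty
  have htend := hF.attracts k {0} Bornology.isBounded_singleton
  have htop : ∀ n, hausdorffSemidist (T.process k n {0}) (F k) = ⊤ := fun n => by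
    obtain ⟨x, hx⟩ := hproc n {0} (singleton_nonempty 0)
    refine top_unique (le_trans ?_ (le_iSup₂ x hx))
    simp [hempty]
  simp only [htop] at htend
  exact ENNReal.top_ne_zero (tendsto_nhds_unique tendsto_const_nhds htend)

theorem mainTheorem1 (d : ℕ) (T : NonautonomousIFS d)
    (F : ℕ → Set (EuclideanSpace ℝ (Fin d)))
    (hF : T.IsPullbackAttractor F)
    (hsim : T.IsSimilarities)
    (hmoran : T.MoranOpenSet)
    (hσ : 0 < ⨅ i, T.σ i)
    (s : ℝ) (hs : 0 < s)
    (hsum : ∀ k, 1 ≤ k → ∑ i ∈ T.I k, T.σ i ^ s = 1) :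
    ∀ k, EquiHomogeneous (F k) ∧ assouadDim (F k) = ENNReal.ofReal s := by
  obtain ⟨U, hUo, hUb, hUstep, hUdisj, ε₀, hε₀, hUv⟩ := hmoran
  set a := ⨅ i, T.σ i
  have haσ : ∀ i, a ≤ T.σ i := fun i =>
    ciInf_le ⟨0, forall_mem_range.2 fun i => (T.σ_pos i).le⟩ i
  have ha1 : a ≤ 1 := (haσ 0).trans (T.σ_lt_one 0).le
  have hI : ∀ k, (T.I (k + 1)).Nonempty := fun k => by
    by_contra hempty
    have := hsum (k + 1) (Nat.le_add_left 1 k)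
    rw [Finset.not_nonempty_iff_eq_empty.1 hempty, Finset.sum_empty] at this
    exact zero_ne_one this
  have hne := hF.nonempty hI
  have hsub : ∀ k r, 0 < r → a * r ≤ 1 → Nonempty (Subdivision F U s a k r) := fun k r hr har =>
    T.nonempty_subdivision hsim hs hσ haσ hF.invariant hUstep hUdisj hsum k hr har
  -- A common bound for the diameters of the sets `F k ∪ U k`.
  obtain ⟨D, hD, hdist⟩ : ∃ D : ℝ, 0 < D ∧
      ∀ x ∈ (⋃ k, F k) ∪ ⋃ k, U k, ∀ y ∈ (⋃ k, F k) ∪ ⋃ k, U k, dist x y ≤ D := by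
    obtain ⟨D, hD⟩ := Metric.isBounded_iff.1 (hF.bounded.union hUb)
    exact ⟨max D 1, lt_max_of_lt_right one_pos,
      fun x hx y hy => (hD hx hy).trans (le_max_left _ _)⟩
  have hFD : ∀ k, ∀ x ∈ F k, ∀ y ∈ F k, dist x y ≤ D := fun k x hx y hy =>
    hdist x (Or.inl (mem_iUnion_of_mem k hx)) y (Or.inl (mem_iUnion_of_mem k hy))
  have hFU : ∀ k, ∀ x ∈ F k, ∀ y ∈ U k, dist y x ≤ D := fun k x hx y hy =>
    hdist y (Or.inr (mem_iUnion_of_mem k hy)) x (Or.inl (mem_iUnion_of_mem k hx))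
  have hN := fun (K : ℝ) (hK : 0 ≤ K) => Subdivision.exists_boundedOverlap (s := s) hσ hε₀ hD.le
    (fun k => (hUo k).1) hUv hFU hK
  intro k
  have hupper := fun δ₀ (hδ₀ : 0 < δ₀) => exists_localCover_le hs hσ ha1 hD hsub hFD hN k hδ₀
  have hlower := fun δ₀ (hδ₀ : 0 < δ₀) => exists_le_localCover hs hσ ha1 hD hne hsub hFD hN k hδ₀
  exact ⟨equiHomogeneous_of_localCover_bounds hupper hlower,
    assouadDim_eq_of_localCover_bounds (hne k) hs.le hupper hlower⟩
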